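/- Let $X$ be a Banach space, let $Y$ be an ordered Banach space with closed positive cone (both real or both complex), and let $S : D(S)\subset X\to Y$ be a closed linear operator. Put $$C:=\overline{\{x\in D(S) : Sx\ge 0\}} ,$$ and, for a linear operator $(A,D(A))$ in $X$, $$C_A:=\overline{\{x\in D(A)\cap D(S) : Sx\ge 0\}} .$$ A strongly continuous semigroup $(T(t))_{t\ge 0}$ of bounded linear operators on $X$ with generator $(A,D(A))$ is called $S$-shape preserving if $C=C_A$ and $T(t)C\subset C$ for all $t\ge 0$. Assume that $(A,D(A))$ generates an $S$-shape preserving strongly continuous semigroup on $X$, and that $B$ is a bounded linear operator on $X$ with $B\,C\subset C$. Then $(A+B,D(A))$ generates a strongly continuous semigroup on $X$, and this semigroup is $S$-shape preserving. -/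

import Mathlib

open Filter Topology Set
open scoped NNReal

/-- A strongly continuous one-parameter semigroup `(T t)_{t ≥ 0}` of bounded linear operators
on the normed space `X`. -/
structure C0Semigroup (𝕜 : Type*) [RCLike 𝕜] (X : Type*) [NormedAddCommGroup X]
    [NormedSpace 𝕜 X] where
  /-- The operator at time `t`. -/
  op : ℝ≥0 → X →L[𝕜] X
  op_zero : op 0 = ContinuousLinearMap.id 𝕜 X
  op_add : ∀ s t : ℝ≥0, op (s + t) = (op s).comp (op t)
  continuous_orbit : ∀ x : X, Continuous fun t : ℝ≥0 => op t x

namespace C0Semigroup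

section

variable {𝕜 : Type*} [RCLike 𝕜] {X : Type*} [NormedAddCommGroup X] [NormedSpace 𝕜 X]

/-- The orbit of `x` has right derivative `y` at time `0`:
`(T t x - x) / t → y` as `t → 0`, `t > 0`. -/
def HasRightDerivAtZero (T : C0Semigroup 𝕜 X) (x y : X) : Prop :=
  Tendsto (fun t : ℝ≥0 => (((t : ℝ) : 𝕜)⁻¹) • (T.op t x - x)) (𝓝[>] 0) (𝓝 y)

theorem HasRightDerivAtZero.unique {T : C0Semigroup 𝕜 X} {x y z : X}
    (hy : T.HasRightDerivAtZero x y) (hz : T.HasRightDerivAtZero x z) : y = z :=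
  tendsto_nhds_unique hy hz

theorem hasRightDerivAtZero_zero (T : C0Semigroup 𝕜 X) : T.HasRightDerivAtZero 0 0 := by
  simp [HasRightDerivAtZero]

theorem HasRightDerivAtZero.add {T : C0Semigroup 𝕜 X} {x y x' y' : X}
    (h : T.HasRightDerivAtZero x y) (h' : T.HasRightDerivAtZero x' y') :
    T.HasRightDerivAtZero (x + x') (y + y') := by
  refine (Tendsto.add h h').congr fun t => ?_
  rw [← smul_add, map_add]
  congr 1
  abel

theorem HasRightDerivAtZero.smul {T : C0Semigroup 𝕜 X} {x y : X} (c : 𝕜)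
    (h : T.HasRightDerivAtZero x y) : T.HasRightDerivAtZero (c • x) (c • y) := by
  refine (Tendsto.const_smul h c).congr fun t => ?_
  rw [map_smul, ← smul_sub, smul_comm]

/-- The generator of the semigroup: its domain consists of the `x` for which
`(T t x - x) / t` converges as `t → 0`, `t > 0`, and its value at `x` is the limit. -/
noncomputable def generator (T : C0Semigroup 𝕜 X) : X →ₗ.[𝕜] X where
  domain :=
    { carrier := {x | ∃ y, T.HasRightDerivAtZero x y}
      zero_mem' := ⟨0, T.hasRightDerivAtZero_zero⟩
      add_mem' := fun ⟨y, hy⟩ ⟨z, hz⟩ => ⟨y + z, hy.add hz⟩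
      smul_mem' := fun c _ ⟨y, hy⟩ => ⟨c • y, hy.smul c⟩ }
  toFun :=
    { toFun := fun x => Classical.choose x.2
      map_add' := fun x x' => (Classical.choose_spec (x + x').2).unique
        ((Classical.choose_spec x.2).add (Classical.choose_spec x'.2))
      map_smul' := fun c x => (Classical.choose_spec (c • x).2).unique
        ((Classical.choose_spec x.2).smul c) }

/-- `x` is in the domain of the generator and is mapped to `y` if and only if
`(T t x - x) / t` converges to `y` as `t → 0`, `t > 0`. -/
theorem mem_graph_generator_iff (T : C0Semigroup 𝕜 X) (x y : X) :
    (x, y) ∈ T.generator.graph ↔ T.HasRightDerivAtZero x y := by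
  rw [LinearPMap.mem_graph_iff]
  constructor
  · rintro ⟨⟨z, hz⟩, rfl, rfl⟩
    exact Classical.choose_spec hz
  · intro h
    exact ⟨⟨x, ⟨y, h⟩⟩, rfl, (Classical.choose_spec (⟨y, h⟩ : ∃ y, _)).unique h⟩

end

end C0Semigroup

section

variable {𝕜 : Type*} [RCLike 𝕜] {X : Type*} [NormedAddCommGroup X] [NormedSpace 𝕜 X]
  {Y : Type*} [NormedAddCommGroup Y] [NormedSpace 𝕜 Y] [PartialOrder Y]

/-- `C`, the closure of `{x ∈ D(S) : S x ≥ 0}`. -/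
def shapeCone (S : X →ₗ.[𝕜] Y) : Set X :=
  closure {x | ∃ hx : x ∈ S.domain, 0 ≤ S ⟨x, hx⟩}

/-- `C_A`, the closure of `{x ∈ D(A) ∩ D(S) : S x ≥ 0}`. -/
def shapeConeOn (S : X →ₗ.[𝕜] Y) (A : X →ₗ.[𝕜] X) : Set X :=
  closure {x | x ∈ A.domain ∧ ∃ hx : x ∈ S.domain, 0 ≤ S ⟨x, hx⟩}

/-- The semigroup `T` with generator `A` preserves `S`-shape: `C = C_A`, and every `T t` maps `C`
into itself. -/
def C0Semigroup.PreservesShape (T : C0Semigroup 𝕜 X) (S : X →ₗ.[𝕜] Y) : Prop :=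
  shapeCone S = shapeConeOn S T.generator ∧
    ∀ t : ℝ≥0, MapsTo (T.op t) (shapeCone S) (shapeCone S)

end

/-! The perturbed semigroup is the solution `U` of the variation of constants formula `U t x = T t x
+ ∫₀ᵗ T (t - r) B (U r x) dr`. After rescaling `T` by an exponential, the integral term becomes a
Volterra operator `V` of norm less than 1 on bounded continuous functions, and `U` is given by the
Neumann series `∑ Vⁿ` applied to the orbits of `T` (`exists_duhamel_of_stable`). The set `C` is a
closed convex cone invariant under `T` and `B`, so every term of the series takes values in `C`, and
so does the sum.

The integral term has right derivative `B x` at 0, so the generator of `U` is `A + B` on `D(A)`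
(`generator_eq_vadd_of_duhamel`). As the domain is unchanged, `C_{A+B} = C_A = C`. Since a generator
determines its semigroup (`eq_of_generator_eq`), the conclusion holds for every semigroup generated
by `A + B`. -/

open scoped BoundedContinuousFunction

namespace C0Semigroup

variable {𝕜 : Type*} [RCLike 𝕜] {X : Type*} [NormedAddCommGroup X] [NormedSpace 𝕜 X]

theorem op_zero_apply (T : C0Semigroup 𝕜 X) (x : X) : T.op 0 x = x := by
  rw [T.op_zero]; rfl

theorem op_add_apply (T : C0Semigroup 𝕜 X) (s t : ℝ≥0) (x : X) :
    T.op (s + t) x = T.op s (T.op t x) := by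
  rw [T.op_add]; rfl

theorem op_comm_apply (T : C0Semigroup 𝕜 X) (s t : ℝ≥0) (x : X) :
    T.op s (T.op t x) = T.op t (T.op s x) := by
  rw [← op_add_apply, add_comm, op_add_apply]

@[ext]
theorem ext {T U : C0Semigroup 𝕜 X} (h : ∀ t x, T.op t x = U.op t x) : T = U := by
  obtain ⟨f, _, _, _⟩ := T
  obtain ⟨g, _, _, _⟩ := U
  obtain rfl : f = g := funext fun t => ContinuousLinearMap.ext (h t)
  rfl

theorem HasRightDerivAtZero.map_op {T : C0Semigroup 𝕜 X} {x y : X}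
    (h : T.HasRightDerivAtZero x y) (s : ℝ≥0) : T.HasRightDerivAtZero (T.op s x) (T.op s y) := by
  refine (((T.op s).continuous.tendsto y).comp h).congr fun t => ?_
  simp [T.op_comm_apply s t]

/-! ### Growth bounds and joint continuity -/

section Bound

variable [CompleteSpace X]

/-- Orbits are bounded on the compact interval `[0, 1]`, so the uniform boundedness principle
applies. -/
theorem exists_norm_op_le_of_le_one (T : C0Semigroup 𝕜 X) :
    ∃ M : ℝ, 1 ≤ M ∧ ∀ t : ℝ≥0, t ≤ 1 → ‖T.op t‖ ≤ M := by
  obtain ⟨M, hM⟩ := banach_steinhaus (g := fun t : Icc (0 : ℝ≥0) 1 => T.op t) fun x => by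
    obtain ⟨c, hc⟩ := (isCompact_Icc (a := (0 : ℝ≥0)) (b := 1)).exists_bound_of_continuousOn
      (T.continuous_orbit x).continuousOn
    exact ⟨c, fun t => hc t t.2⟩
  exact ⟨max 1 M, le_max_left _ _, fun t ht => (hM ⟨t, zero_le, ht⟩).trans (le_max_right _ _)⟩

/-- A strongly continuous semigroup is exponentially bounded. -/
theorem exists_norm_op_le_exp (T : C0Semigroup 𝕜 X) :
    ∃ M ω : ℝ, 0 < M ∧ ∀ t : ℝ≥0, ‖T.op t‖ ≤ M * Real.exp (ω * t) := by
  obtain ⟨M, hM1, hM⟩ := T.exists_norm_op_le_of_le_one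
  have hM0 : 0 < M := one_pos.trans_le hM1
  have key : ∀ (n : ℕ) (t : ℝ≥0), t ≤ n + 1 → ‖T.op t‖ ≤ M ^ (n + 1) := by
    intro n
    induction n with
    | zero => intro t ht; simpa using hM t (by simpa using ht)
    | succ n ih =>
      intro t ht
      rcases le_total t 1 with h | h
      · exact (hM t h).trans (le_self_pow₀ hM1 (by omega))
      · obtain ⟨s, rfl⟩ := exists_add_of_le h
        rw [T.op_add, pow_succ']
        refine (ContinuousLinearMap.opNorm_comp_le _ _).trans ?_
        have hs : s ≤ n + 1 := by
          push_cast at ht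
          rw [add_comm] at ht
          exact le_of_add_le_add_right ht
        exact mul_le_mul (hM 1 le_rfl) (ih s hs) (norm_nonneg _) hM0.le
  -- With `n = ⌊t⌋` the bound is `M * M ^ n ≤ M * M ^ t = M * exp (t log M)`.
  refine ⟨M, Real.log M, hM0, fun t => ?_⟩
  refine (key ⌊t⌋₊ t (Nat.lt_floor_add_one t).le).trans ?_
  rw [pow_succ']
  gcongr
  rw [← Real.rpow_def_of_pos hM0, ← Real.rpow_natCast]
  exact Real.rpow_le_rpow_of_exponent_le hM1 (by exact_mod_cast Nat.floor_le t.2)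

theorem continuous_uncurry (T : C0Semigroup 𝕜 X) :
    Continuous fun p : ℝ≥0 × X => T.op p.1 p.2 := by
  obtain ⟨M, ω, hM, h⟩ := T.exists_norm_op_le_exp
  rw [continuous_iff_continuousAt]
  rintro ⟨t₀, x₀⟩
  rw [ContinuousAt, tendsto_iff_norm_sub_tendsto_zero]
  have hc : Continuous fun p : ℝ≥0 × X =>
      M * Real.exp (ω * p.1) * ‖p.2 - x₀‖ + ‖T.op p.1 x₀ - T.op t₀ x₀‖ := by
    have := (T.continuous_orbit x₀).comp (continuous_fst (X := ℝ≥0) (Y := X))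
    simp only [Function.comp_def] at this
    fun_prop
  refine squeeze_zero (fun _ => norm_nonneg _) (fun p => ?_)
    (by simpa using hc.tendsto (t₀, x₀))
  calc ‖T.op p.1 p.2 - T.op t₀ x₀‖
      = ‖T.op p.1 (p.2 - x₀) + (T.op p.1 x₀ - T.op t₀ x₀)‖ := by rw [map_sub]; abel_nf
    _ ≤ _ := (norm_add_le _ _).trans (by gcongr; exact (T.op p.1).le_of_opNorm_le (h _) _)

theorem continuous_op_apply (T : C0Semigroup 𝕜 X) {Z : Type*} [TopologicalSpace Z] {f : Z → ℝ≥0}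
    {g : Z → X} (hf : Continuous f) (hg : Continuous g) : Continuous fun z => T.op (f z) (g z) :=
  T.continuous_uncurry.comp (hf.prodMk hg)

end Bound

/-! ### Derivatives in real time, rescaling, uniqueness from the generator -/

section Real

variable [NormedSpace ℝ X] [IsScalarTower ℝ 𝕜 X]

theorem hasRightDerivAtZero_iff_hasDerivWithinAt (T : C0Semigroup 𝕜 X) (x y : X) :
    T.HasRightDerivAtZero x y ↔
      HasDerivWithinAt (fun r : ℝ => T.op r.toNNReal x) y (Ioi 0) 0 := by
  have h1 : Tendsto ((↑) : ℝ≥0 → ℝ) (𝓝[>] 0) (𝓝[>] 0) :=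
    tendsto_nhdsWithin_iff.2 ⟨tendsto_nhdsWithin_of_tendsto_nhds
      (by simpa using (NNReal.continuous_coe.tendsto 0)),
      eventually_mem_nhdsWithin.mono fun t ht => NNReal.coe_pos.2 ht⟩
  have h2 : Tendsto Real.toNNReal (𝓝[>] 0) (𝓝[>] 0) :=
    tendsto_nhdsWithin_iff.2 ⟨tendsto_nhdsWithin_of_tendsto_nhds
      (by simpa using (continuous_real_toNNReal.tendsto 0)),
      eventually_mem_nhdsWithin.mono fun t ht => Real.toNNReal_pos.2 ht⟩
  have hs : ∀ (r : ℝ) (z : X), ((r : 𝕜)⁻¹) • z = r⁻¹ • z := fun r z => by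
    rw [← RCLike.ofReal_inv, ← algebraMap_smul 𝕜 r⁻¹ z]
  rw [hasDerivWithinAt_iff_tendsto_slope' (by simp), HasRightDerivAtZero]
  constructor
  · intro h
    refine (h.comp h2).congr' (eventually_mem_nhdsWithin.mono fun r hr => ?_)
    simp [slope_def_module, hs, op_zero_apply, Real.coe_toNNReal r (le_of_lt hr)]
  · intro h
    refine (h.comp h1).congr fun r => ?_
    simp [slope_def_module, hs, op_zero_apply]

theorem HasRightDerivAtZero.tendsto_real {T : C0Semigroup 𝕜 X} {x y : X}
    (h : T.HasRightDerivAtZero x y) :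
    Tendsto (fun r : ℝ => r⁻¹ • (T.op r.toNNReal x - x)) (𝓝[>] 0) (𝓝 y) := by
  have := (hasDerivWithinAt_iff_tendsto_slope' (s := Ioi (0 : ℝ)) (by simp)).1
    ((T.hasRightDerivAtZero_iff_hasDerivWithinAt x y).1 h)
  refine this.congr fun r => ?_
  simp [slope_def_module, op_zero_apply]

/-- The semigroup `t ↦ exp (c t) T t`. -/
noncomputable def rescale (T : C0Semigroup 𝕜 X) (c : ℝ) : C0Semigroup 𝕜 X where
  op t := Real.exp (c * t) • T.op t
  op_zero := by simp [T.op_zero]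
  op_add s t := by
    ext x
    simp [op_add_apply, mul_add, Real.exp_add, mul_smul, smul_comm (Real.exp (c * s))]
  continuous_orbit x := by
    have := T.continuous_orbit x
    simp only [smul_apply]
    fun_prop

theorem rescale_op_apply (T : C0Semigroup 𝕜 X) (c : ℝ) (t : ℝ≥0) (x : X) :
    (T.rescale c).op t x = Real.exp (c * t) • T.op t x := rfl

variable [CompleteSpace X]

/-- By translation, `T h` maps the integral over `[0, t]` to the integral over `[h, h + t]`, which
is differentiated in its endpoints. -/
theorem hasRightDerivAtZero_integral (T : C0Semigroup 𝕜 X) (x : X) (t : ℝ≥0) :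
    T.HasRightDerivAtZero (∫ r in (0 : ℝ)..t, T.op r.toNNReal x) (T.op t x - x) := by
  rw [hasRightDerivAtZero_iff_hasDerivWithinAt]
  have hc : Continuous fun r : ℝ => T.op r.toNNReal x :=
    (T.continuous_orbit x).comp continuous_real_toNNReal
  have hI : ∀ a b, IntervalIntegrable (fun r : ℝ => T.op r.toNNReal x) MeasureTheory.volume a b :=
    fun a b => hc.intervalIntegrable a b
  have hF : ∀ b : ℝ, HasDerivAt (fun u : ℝ => ∫ r in (0 : ℝ)..u, T.op r.toNNReal x)
      (T.op b.toNNReal x) b := fun b => hc.integral_hasStrictDerivAt 0 b |>.hasDerivAt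
  have hd : HasDerivAt (fun h : ℝ => (∫ r in (0 : ℝ)..(h + t), T.op r.toNNReal x) -
      ∫ r in (0 : ℝ)..h, T.op r.toNNReal x) (T.op t x - x) 0 := by
    have h1 := HasDerivAt.comp_add_const (0 : ℝ) (t : ℝ) (hF (0 + t))
    convert h1.sub (hF 0) using 1 <;> simp [op_zero_apply, Pi.sub_def]
  have hf : ∀ h : ℝ, 0 ≤ h → T.op h.toNNReal (∫ r in (0 : ℝ)..t, T.op r.toNNReal x) =
      (∫ r in (0 : ℝ)..(h + t), T.op r.toNNReal x) - ∫ r in (0 : ℝ)..h, T.op r.toNNReal x := by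
    intro h hh
    rw [← (T.op h.toNNReal).intervalIntegral_comp_comm (hI _ _),
      intervalIntegral.integral_interval_sub_left (hI _ _) (hI _ _)]
    have := intervalIntegral.integral_comp_add_left (a := (0 : ℝ)) (b := t)
      (fun r : ℝ => T.op r.toNNReal x) h
    rw [add_zero] at this
    rw [← this]
    refine intervalIntegral.integral_congr fun r hr => ?_
    rw [uIcc_of_le t.coe_nonneg] at hr
    simp only [Real.toNNReal_add hh hr.1, op_add_apply]
  exact hd.hasDerivWithinAt.congr (fun h hh => hf h (le_of_lt hh)) (hf 0 le_rfl)

/-- The generator of a strongly continuous semigroup is densely defined. -/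
theorem dense_generator_domain (T : C0Semigroup 𝕜 X) : Dense (T.generator.domain : Set X) := by
  intro x
  have hc : Continuous fun r : ℝ => T.op r.toNNReal x :=
    (T.continuous_orbit x).comp continuous_real_toNNReal
  have h := (hasDerivAt_iff_tendsto_slope.1 (hc.integral_hasStrictDerivAt 0 0).hasDerivAt).mono_left
    (nhdsGT_le_nhdsNE (0 : ℝ))
  simp only [Real.toNNReal_zero, op_zero_apply] at h
  -- The means `r⁻¹ ∫₀ʳ T s x ds` lie in the domain and tend to `x`.
  refine mem_closure_of_tendsto h (eventually_mem_nhdsWithin.mono fun r hr => ?_)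
  lift r to ℝ≥0 using le_of_lt hr
  have hm : (∫ s in (0 : ℝ)..r, T.op s.toNNReal x) ∈ T.generator.domain :=
    ⟨_, T.hasRightDerivAtZero_integral x r⟩
  simp only [slope_def_module, intervalIntegral.integral_same, sub_zero]
  rw [← algebraMap_smul 𝕜 ((r : ℝ)⁻¹)]
  exact T.generator.domain.smul_mem _ hm

/-- The slope from `s` to `r` is `T (t - r)` applied to the difference of the quotients of `U` and
`T` at `z`. These share the limit `w`, so joint continuity gives the limit 0. -/
theorem hasDerivWithinAt_op_sub_op {T U : C0Semigroup 𝕜 X} {z w : X} {s t : ℝ} (hs : 0 ≤ s)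
    (hst : s < t) (x : X) (hz : U.op s.toNNReal x = z) (hT : T.HasRightDerivAtZero z w)
    (hU : U.HasRightDerivAtZero z w) :
    HasDerivWithinAt (fun r : ℝ => T.op (t - r).toNNReal (U.op r.toNNReal x)) 0 (Ici s) s := by
  rw [← hasDerivWithinAt_Ioi_iff_Ici, hasDerivWithinAt_iff_tendsto_slope' (by simp)]
  have hsub : Tendsto (fun r : ℝ => r - s) (𝓝[>] s) (𝓝[>] 0) := by
    refine tendsto_nhdsWithin_iff.2 ⟨tendsto_nhdsWithin_of_tendsto_nhds ?_,
      eventually_mem_nhdsWithin.mono fun r (hr : s < r) => mem_Ioi.2 (sub_pos.2 hr)⟩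
    simpa using (continuous_sub_right s).tendsto s
  have h1 := (hU.tendsto_real.comp hsub).sub (hT.tendsto_real.comp hsub)
  have h2 : Tendsto (fun r : ℝ => (t - r).toNNReal) (𝓝[>] s) (𝓝 (t - s).toNNReal) :=
    tendsto_nhdsWithin_of_tendsto_nhds (Continuous.tendsto (by fun_prop) s)
  have h3 := (T.continuous_uncurry.tendsto _).comp (h2.prodMk_nhds h1)
  simp only [sub_self, map_zero] at h3
  refine h3.congr' ?_
  filter_upwards [Ioo_mem_nhdsGT hst] with r hr
  have e1 : r.toNNReal = (r - s).toNNReal + s.toNNReal := by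
    rw [← Real.toNNReal_add (sub_nonneg.2 hr.1.le) hs, sub_add_cancel]
  have e2 : (t - s).toNNReal = (t - r).toNNReal + (r - s).toNNReal := by
    rw [← Real.toNNReal_add (sub_nonneg.2 hr.2.le) (sub_nonneg.2 hr.1.le), sub_add_sub_cancel]
  simp only [Function.comp_apply, slope_def_module, hz]
  rw [e1, e2, op_add_apply, op_add_apply, hz, ← map_sub, ← smul_sub, sub_sub_sub_cancel_right,
    (T.op _).map_smul_of_tower]

/-- A strongly continuous semigroup is determined by its generator. -/
theorem eq_of_generator_eq {T U : C0Semigroup 𝕜 X} (h : T.generator = U.generator) : T = U := by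
  ext t x
  revert x
  have : ∀ x, T.op t x = U.op t x := by
    refine congrFun (Continuous.ext_on T.dense_generator_domain (T.op t).continuous
      (U.op t).continuous ?_)
    intro x hx
    have hU : ∃ y, U.HasRightDerivAtZero x y := by
      rw [h] at hx; exact hx
    obtain ⟨y, hy⟩ := hU
    have key := constant_of_has_deriv_right_zero (a := 0) (b := t)
      (f := fun r : ℝ => T.op (t - r).toNNReal (U.op r.toNNReal x))
      (Continuous.continuousOn (T.continuous_op_apply (by fun_prop)
        ((U.continuous_orbit x).comp continuous_real_toNNReal)))
      (fun s hs => by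
        have hz := hy.map_op s.toNNReal
        refine hasDerivWithinAt_op_sub_op hs.1 hs.2 x rfl ?_ hz
        rwa [← mem_graph_generator_iff, h, mem_graph_generator_iff])
      t ⟨t.2, le_rfl⟩
    simpa [op_zero_apply] using key.symm
  exact this

/-- The order of quantifiers matters: `M` does not depend on `δ`, so the decay rate can later be
chosen in terms of `M * ‖B‖`. -/
theorem exists_norm_rescale_op_le (T : C0Semigroup 𝕜 X) :
    ∃ M : ℝ, 0 < M ∧ ∀ δ : ℝ, ∃ c : ℝ, ∀ t : ℝ≥0,
      ‖(T.rescale c).op t‖ ≤ M * Real.exp (-δ * t) := by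
  obtain ⟨M, ω, hM, h⟩ := T.exists_norm_op_le_exp
  refine ⟨M, hM, fun δ => ⟨-δ - ω, fun t => ?_⟩⟩
  calc ‖Real.exp ((-δ - ω) * t) • T.op t‖ ≤ Real.exp ((-δ - ω) * t) * (M * Real.exp (ω * t)) := by
        rw [norm_smul, Real.norm_of_nonneg (Real.exp_pos _).le]
        gcongr
        exact h t
    _ = M * Real.exp (-δ * t) := by
        rw [mul_left_comm, ← Real.exp_add]
        ring_nf

end Real

end C0Semigroup

/-- The integral of a continuous function with values in a closed cone lies in the cone. -/
theorem PointedCone.intervalIntegral_mem {X : Type*} [NormedAddCommGroup X] [NormedSpace ℝ X]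
    [CompleteSpace X] {C : PointedCone ℝ X} (hC : IsClosed (C : Set X)) {f : ℝ → X}
    (hf : Continuous f) {a b : ℝ} (hab : a ≤ b) (h : ∀ r ∈ Icc a b, f r ∈ C) :
    ∫ r in a..b, f r ∈ C := by
  rcases hab.eq_or_lt with rfl | hlt
  · simp
  have hconv : Convex ℝ (C : Set X) := fun x hx y hy s t hs ht _ =>
    C.add_mem (C.smul_mem hs hx) (C.smul_mem ht hy)
  -- Averages stay in a closed convex set; multiplying by the length `b - a` recovers the integral.
  have hm : (⨍ r in Ioc a b, f r) ∈ (C : Set X) := by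
    refine hconv.set_average_mem hC (by simpa using hlt) (by simp) ?_ ?_
    · exact (MeasureTheory.ae_restrict_iff' measurableSet_Ioc).2
        (Eventually.of_forall fun r hr => h r (Ioc_subset_Icc_self hr))
    · exact (hf.continuousOn.integrableOn_Icc).mono_set Ioc_subset_Icc_self
  have hmem := C.smul_mem (sub_nonneg.2 hab) hm
  have hv : MeasureTheory.volume.real (Ioc a b) = b - a := by simp [hab]
  rw [MeasureTheory.setAverage_eq, hv, smul_inv_smul₀ (sub_pos.2 hlt).ne'] at hmem
  rwa [intervalIntegral.integral_of_le hab]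

/-! ### The variation of constants integral -/

namespace C0Semigroup

variable {𝕜 : Type*} [RCLike 𝕜] {X : Type*} [NormedAddCommGroup X] [NormedSpace 𝕜 X]

section Integrand

variable [CompleteSpace X]

theorem continuous_duhamel_integrand (T : C0Semigroup 𝕜 X) (B : X →L[𝕜] X) {f : ℝ≥0 → X}
    (hf : Continuous f) :
    Continuous fun p : ℝ × ℝ => T.op (p.1 - p.2).toNNReal (B (f p.2.toNNReal)) :=
  T.continuous_op_apply (by fun_prop) (by fun_prop)

theorem continuous_duhamel_integrand_right (T : C0Semigroup 𝕜 X) (B : X →L[𝕜] X) {f : ℝ≥0 → X}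
    (hf : Continuous f) (t : ℝ) :
    Continuous fun r : ℝ => T.op (t - r).toNNReal (B (f r.toNNReal)) :=
  (T.continuous_duhamel_integrand B hf).comp (by fun_prop : Continuous fun r : ℝ => (t, r))

end Integrand

variable [NormedSpace ℝ X]

/-- The convolution `∫₀ᵗ T (t - r) B f(r) dr`. -/
noncomputable def duhamel (T : C0Semigroup 𝕜 X) (B : X →L[𝕜] X) (f : ℝ≥0 → X) (t : ℝ≥0) : X :=
  ∫ r in (0 : ℝ)..t, T.op (t - r).toNNReal (B (f r.toNNReal))

theorem duhamel_smul_fun [IsScalarTower ℝ 𝕜 X] (T : C0Semigroup 𝕜 X) (B : X →L[𝕜] X) (c : 𝕜) (f : ℝ≥0 → X)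
    (t : ℝ≥0) :
    T.duhamel B (fun r => c • f r) t = c • T.duhamel B f t := by
  simp only [duhamel, map_smul]
  exact intervalIntegral.integral_smul c _

/-- The factor `1 / δ` bounds `∫₀ᵗ exp (-δ (t - r)) dr` uniformly in `t`. -/
theorem norm_duhamel_le {T : C0Semigroup 𝕜 X} {M δ : ℝ} (hM : 0 ≤ M) (hδ : 0 < δ)
    (hT : ∀ t, ‖T.op t‖ ≤ M * Real.exp (-δ * t)) (B : X →L[𝕜] X) {f : ℝ≥0 → X}
    {c : ℝ} (hc : 0 ≤ c) (hfc : ∀ t, ‖f t‖ ≤ c) (t : ℝ≥0) :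
    ‖T.duhamel B f t‖ ≤ M * ‖B‖ / δ * c := by
  have hint : ∫ r in (0 : ℝ)..t, M * ‖B‖ * c * Real.exp (-δ * (t - r)) =
      M * ‖B‖ * c * (δ⁻¹ * (1 - Real.exp (-δ * t))) := by
    rw [intervalIntegral.integral_const_mul]
    congr 1
    have hd : ∀ r ∈ uIcc (0 : ℝ) t, HasDerivAt (fun r : ℝ => δ⁻¹ * Real.exp (-δ * (t - r)))
        (Real.exp (-δ * (t - r))) r := by
      intro r _
      have := ((((hasDerivAt_id r).const_sub (t : ℝ)).const_mul (-δ)).exp).const_mul δ⁻¹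
      refine this.congr_deriv ?_
      simp only [id_eq]
      field_simp
    rw [intervalIntegral.integral_eq_sub_of_hasDerivAt hd
      (Continuous.intervalIntegrable (by fun_prop) _ _)]
    simp
    ring
  calc ‖T.duhamel B f t‖ ≤ ∫ r in (0 : ℝ)..t, M * ‖B‖ * c * Real.exp (-δ * (t - r)) := by
        refine intervalIntegral.norm_integral_le_of_norm_le t.coe_nonneg
          (Eventually.of_forall fun r hr => ?_)
          (Continuous.intervalIntegrable (by fun_prop) _ _)
        calc ‖T.op (t - r).toNNReal (B (f r.toNNReal))‖
            ≤ (M * Real.exp (-δ * (t - r).toNNReal)) * (‖B‖ * c) :=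
              (T.op _).le_of_opNorm_le_of_le (hT _) (B.le_opNorm_of_le (hfc _))
          _ = _ := by rw [Real.coe_toNNReal _ (sub_nonneg.2 hr.2)]; ring
    _ = M * ‖B‖ * c * (δ⁻¹ * (1 - Real.exp (-δ * t))) := hint
    _ ≤ M * ‖B‖ * c * (δ⁻¹ * 1) := by
        gcongr
        linarith [Real.exp_pos (-δ * t)]
    _ = _ := by ring

variable [CompleteSpace X]

theorem continuous_duhamel (T : C0Semigroup 𝕜 X) (B : X →L[𝕜] X) {f : ℝ≥0 → X}
    (hf : Continuous f) : Continuous (T.duhamel B f) :=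
  (intervalIntegral.continuous_parametric_intervalIntegral_of_continuous (a₀ := 0)
    (f := fun t r => T.op (t - r).toNNReal (B (f r.toNNReal))) (μ := MeasureTheory.volume)
    (T.continuous_duhamel_integrand B hf) continuous_id).comp NNReal.continuous_coe

theorem duhamel_add_fun (T : C0Semigroup 𝕜 X) (B : X →L[𝕜] X) {f g : ℝ≥0 → X}
    (hf : Continuous f) (hg : Continuous g) (t : ℝ≥0) :
    T.duhamel B (fun r => f r + g r) t = T.duhamel B f t + T.duhamel B g t := by
  simp only [duhamel, map_add]
  exact intervalIntegral.integral_add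
    ((T.continuous_duhamel_integrand_right B hf t).intervalIntegrable _ _)
    ((T.continuous_duhamel_integrand_right B hg t).intervalIntegrable _ _)

/-- Splitting the integral at `s` gives this cocycle identity, the source of the semigroup law for
`U`. -/
theorem duhamel_time_add (T : C0Semigroup 𝕜 X) (B : X →L[𝕜] X) {f : ℝ≥0 → X}
    (hf : Continuous f) (s t : ℝ≥0) :
    T.duhamel B f (t + s) = T.op t (T.duhamel B f s) + T.duhamel B (fun r => f (r + s)) t := by
  have hc := T.continuous_duhamel_integrand_right B hf
  have hI := fun u a b => (hc u).intervalIntegrable (μ := MeasureTheory.volume) a b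
  rw [duhamel, ← intervalIntegral.integral_add_adjacent_intervals (hI _ 0 s) (hI _ s _)]
  congr 1
  · rw [duhamel, ← (T.op t).intervalIntegral_comp_comm (hI _ _ _)]
    refine intervalIntegral.integral_congr fun r hr => ?_
    rw [uIcc_of_le s.coe_nonneg] at hr
    simp only [← op_add_apply]
    congr 2
    rw [NNReal.coe_add, add_sub_assoc, Real.toNNReal_add t.coe_nonneg (sub_nonneg.2 hr.2),
      Real.toNNReal_coe]
  · have := intervalIntegral.integral_comp_add_right (a := (0 : ℝ)) (b := t)
      (fun r : ℝ => T.op (((t + s : ℝ≥0) : ℝ) - r).toNNReal (B (f r.toNNReal))) s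
    rw [zero_add, ← NNReal.coe_add] at this
    rw [← this, duhamel]
    refine intervalIntegral.integral_congr fun r hr => ?_
    rw [uIcc_of_le t.coe_nonneg] at hr
    simp only [NNReal.coe_add, add_sub_add_right_eq_sub, Real.toNNReal_add hr.1 s.coe_nonneg,
      Real.toNNReal_coe]

theorem duhamel_mem {T : C0Semigroup 𝕜 X} {B : X →L[𝕜] X} {C : PointedCone ℝ X}
    (hC : IsClosed (C : Set X)) (hT : ∀ t, MapsTo (T.op t) C C) (hB : MapsTo B C C)
    {f : ℝ≥0 → X} (hf : Continuous f) (hfC : ∀ t, f t ∈ C) (t : ℝ≥0) : T.duhamel B f t ∈ C :=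
  PointedCone.intervalIntegral_mem hC (T.continuous_duhamel_integrand_right B hf t) t.2
    fun _ _ => hT _ (hB (hfC _))

/-- The integrand is jointly continuous in `(t, r)` with value `B (f 0)` at the origin, so its means
over `[0, t]` tend to that value. -/
theorem hasDerivWithinAt_duhamel (T : C0Semigroup 𝕜 X) (B : X →L[𝕜] X) {f : ℝ≥0 → X}
    (hf : Continuous f) :
    HasDerivWithinAt (fun r : ℝ => T.duhamel B f r.toNNReal) (B (f 0)) (Ioi 0) 0 := by
  rw [hasDerivWithinAt_iff_tendsto_slope' (by simp), Metric.tendsto_nhdsWithin_nhds]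
  intro ε hε
  have h0 := (T.continuous_duhamel_integrand B hf).tendsto (0, 0)
  simp only [sub_zero, Real.toNNReal_zero, op_zero_apply] at h0
  obtain ⟨η, hη, h⟩ := Metric.tendsto_nhds_nhds.1 h0 (ε / 2) (half_pos hε)
  refine ⟨η, hη, fun {t} ht htη => ?_⟩
  have ht : 0 < t := ht
  rw [Real.dist_eq, sub_zero, abs_of_pos ht] at htη
  have hc := (T.continuous_duhamel_integrand_right B hf t).intervalIntegrable
    (μ := MeasureTheory.volume) 0 t
  have hn : ‖∫ r in (0 : ℝ)..t, (T.op (t - r).toNNReal (B (f r.toNNReal)) - B (f 0))‖ ≤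
      ε / 2 * |t - 0| := by
    refine intervalIntegral.norm_integral_le_of_norm_le_const fun r hr => ?_
    rw [uIoc_of_le ht.le] at hr
    rw [← dist_eq_norm]
    refine (h (x := (t, r)) ?_).le
    rw [Prod.dist_eq, max_lt_iff]
    simp only [Real.dist_eq, sub_zero, abs_of_pos ht, abs_of_pos hr.1]
    exact ⟨htη, hr.2.trans_lt htη⟩
  rw [intervalIntegral.integral_sub hc (by simp), intervalIntegral.integral_const, sub_zero,
    abs_of_pos ht] at hn
  have e : slope (fun r : ℝ => T.duhamel B f r.toNNReal) 0 t - B (f 0) = t⁻¹ •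
      ((∫ r in (0 : ℝ)..t, T.op (t - r).toNNReal (B (f r.toNNReal))) - t • B (f 0)) := by
    rw [smul_sub, inv_smul_smul₀ ht.ne']
    simp [slope_def_module, duhamel, max_eq_left ht.le]
  rw [dist_eq_norm, e, norm_smul, norm_inv, Real.norm_of_nonneg ht.le, inv_mul_lt_iff₀ ht]
  nlinarith

end C0Semigroup

/-! ### Construction of the perturbed semigroup and its generator -/

namespace C0Semigroup

variable {𝕜 : Type*} [RCLike 𝕜] {X : Type*} [NormedAddCommGroup X] [NormedSpace 𝕜 X]
  [NormedSpace ℝ X] [CompleteSpace X]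

section Stable

variable [IsScalarTower ℝ 𝕜 X] {T : C0Semigroup 𝕜 X} {M δ : ℝ}

/-- The Volterra operator `f ↦ ∫₀ᵗ T (t - r) B f(r) dr` on bounded continuous functions, for an
exponentially stable semigroup. -/
noncomputable def volterra (hM : 0 ≤ M) (hδ : 0 < δ)
    (hT : ∀ t, ‖T.op t‖ ≤ M * Real.exp (-δ * t)) (B : X →L[𝕜] X) :
    (ℝ≥0 →ᵇ X) →L[𝕜] (ℝ≥0 →ᵇ X) :=
  LinearMap.mkContinuous
    { toFun := fun f => BoundedContinuousFunction.ofNormedAddCommGroup (T.duhamel B f)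
        (T.continuous_duhamel B f.continuous) (M * ‖B‖ / δ * ‖f‖)
        (norm_duhamel_le hM hδ hT B (norm_nonneg f) f.norm_coe_le_norm)
      map_add' := fun f g => by
        ext t
        exact T.duhamel_add_fun B f.continuous g.continuous t
      map_smul' := fun c f => by
        ext t
        exact T.duhamel_smul_fun B c f t }
    (M * ‖B‖ / δ) fun f => BoundedContinuousFunction.norm_ofNormedAddCommGroup_le _
      (by positivity) (norm_duhamel_le hM hδ hT B (norm_nonneg f) f.norm_coe_le_norm)

theorem norm_volterra_le (hM : 0 ≤ M) (hδ : 0 < δ)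
    (hT : ∀ t, ‖T.op t‖ ≤ M * Real.exp (-δ * t)) (B : X →L[𝕜] X) :
    ‖volterra hM hδ hT B‖ ≤ M * ‖B‖ / δ :=
  LinearMap.mkContinuous_norm_le _ (div_nonneg (mul_nonneg hM (norm_nonneg B)) hδ.le) _

/-- The orbit map `x ↦ T (·) x` into the bounded continuous functions, for an exponentially stable
semigroup. -/
noncomputable def orbitMap (hδ : 0 < δ) (hT : ∀ t, ‖T.op t‖ ≤ M * Real.exp (-δ * t)) :
    X →L[𝕜] (ℝ≥0 →ᵇ X) :=
  have hTM : ∀ t, ‖T.op t‖ ≤ |M| := fun t => (hT t).trans <| by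
    have h1 : Real.exp (-δ * t) ≤ 1 :=
      Real.exp_le_one_iff.2 (mul_nonpos_of_nonpos_of_nonneg (neg_nonpos.2 hδ.le) t.2)
    exact (mul_le_mul_of_nonneg_right (le_abs_self M) (Real.exp_pos _).le).trans
      (mul_le_of_le_one_right (abs_nonneg M) h1)
  LinearMap.mkContinuous
    { toFun := fun x => BoundedContinuousFunction.ofNormedAddCommGroup (fun t => T.op t x)
        (T.continuous_orbit x) (|M| * ‖x‖) fun t => (T.op t).le_of_opNorm_le (hTM t) x
      map_add' := fun x y => by ext t; simp
      map_smul' := fun c x => by ext t; simp }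
    |M| fun x => BoundedContinuousFunction.norm_ofNormedAddCommGroup_le _ (by positivity)
      fun t => (T.op t).le_of_opNorm_le (hTM t) x

/-- An exponentially stable semigroup has a perturbation by every sufficiently small bounded
operator, which leaves invariant every closed cone invariant under the semigroup and the
operator. -/
theorem exists_duhamel_of_stable (hM : 0 ≤ M) (hδ : 0 < δ)
    (hT : ∀ t, ‖T.op t‖ ≤ M * Real.exp (-δ * t)) (B : X →L[𝕜] X) (hB : M * ‖B‖ / δ < 1) :
    ∃ U : C0Semigroup 𝕜 X,
      (∀ t x, U.op t x = T.op t x + T.duhamel B (fun r => U.op r x) t) ∧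
      ∀ C : PointedCone ℝ X, IsClosed (C : Set X) → (∀ t, MapsTo (T.op t) C C) → MapsTo B C C →
        ∀ t, MapsTo (U.op t) C C := by
  set V := volterra hM hδ hT B
  have hV : ‖V‖ < 1 := (norm_volterra_le hM hδ hT B).trans_lt hB
  set R : (ℝ≥0 →ᵇ X) →L[𝕜] (ℝ≥0 →ᵇ X) := ∑' n : ℕ, V ^ n
  have hVR : ∀ f, R f - V (R f) = f := fun f => DFunLike.congr_fun (mul_neg_geom_series V hV) f
  have hRV : ∀ f, R (f - V f) = f := fun f => DFunLike.congr_fun (geom_series_mul_neg V hV) f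
  set u : X →L[𝕜] (ℝ≥0 →ᵇ X) := R.comp (orbitMap hδ hT)
  have hu : ∀ t x, u x t = T.op t x + T.duhamel B (u x) t := fun t x => by
    have := DFunLike.congr_fun (hVR (orbitMap hδ hT x)) t
    exact eq_add_of_sub_eq this
  -- The shifted orbit solves the same equation with initial value `u x s`; since `R` is a left
  -- inverse of `1 - V`, solutions are unique.
  have hshift : ∀ (s t : ℝ≥0) x, u x (t + s) = u (u x s) t := by
    intro s t x
    set f : ℝ≥0 →ᵇ X := (u x).compContinuous ⟨fun t => t + s, by fun_prop⟩
    have hf : f - V f = orbitMap hδ hT (u x s) := by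
      ext t
      change u x (t + s) - T.duhamel B (fun r => u x (r + s)) t = T.op t (u x s)
      rw [hu (t + s) x, hu s x, duhamel_time_add _ _ (u x).continuous, map_add, op_add_apply]
      abel
    have := hRV f
    rw [hf] at this
    exact (DFunLike.congr_fun this t).symm
  refine ⟨⟨fun t => (BoundedContinuousFunction.evalCLM 𝕜 t).comp u, ?_, ?_, ?_⟩, ?_, ?_⟩
  · ext x
    simp [hu 0 x, op_zero_apply, duhamel]
  · intro s t
    ext x
    simp [hshift]
  · intro x
    exact (u x).continuous
  · exact fun t x => hu t x
  · intro C hC hTC hBC t x hx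
    have hpow : ∀ (n : ℕ) t, (V ^ n) (orbitMap hδ hT x) t ∈ C := by
      intro n
      induction n with
      | zero => exact fun t => hTC t hx
      | succ n ih =>
        intro t
        rw [pow_succ']
        exact duhamel_mem hC hTC hBC (BoundedContinuousFunction.continuous _) ih t
    have hs := (summable_geometric_of_norm_lt_one hV).hasSum.mapL
      ((BoundedContinuousFunction.evalCLM 𝕜 t).comp
        (ContinuousLinearMap.apply 𝕜 (ℝ≥0 →ᵇ X) (orbitMap hδ hT x)))
    exact hC.mem_of_tendsto hs (Eventually.of_forall fun F => C.sum_mem fun n _ => hpow n t)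

end Stable

/-- Every bounded perturbation of a semigroup exists, in the sense of the variation of constants
formula, and leaves invariant every closed cone invariant under the semigroup and the
perturbation. -/
theorem exists_duhamel [IsScalarTower ℝ 𝕜 X] (T : C0Semigroup 𝕜 X) (B : X →L[𝕜] X) :
    ∃ U : C0Semigroup 𝕜 X,
      (∀ t x, U.op t x = T.op t x + T.duhamel B (fun r => U.op r x) t) ∧
      ∀ C : PointedCone ℝ X, IsClosed (C : Set X) → (∀ t, MapsTo (T.op t) C C) → MapsTo B C C →
        ∀ t, MapsTo (U.op t) C C := by
  obtain ⟨M, hM, h⟩ := T.exists_norm_rescale_op_le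
  -- This decay rate makes the Volterra bound `M * ‖B‖ / δ` less than 1.
  have hδ : 0 < M * ‖B‖ + 1 := by positivity
  obtain ⟨c, hc⟩ := h (M * ‖B‖ + 1)
  obtain ⟨W, hW, hWC⟩ := exists_duhamel_of_stable hM.le hδ hc B
    ((div_lt_one hδ).2 (lt_add_one _))
  refine ⟨W.rescale (-c), fun t x => ?_, fun C hC hTC hBC t x hx => ?_⟩
  · rw [rescale_op_apply, hW, smul_add, rescale_op_apply, smul_smul, ← Real.exp_add]
    congr 1
    · simp
    -- The formula survives rescaling because `exp (-c t) = exp (-c (t - r)) * exp (-c r)`.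
    · simp only [duhamel]
      rw [← intervalIntegral.integral_smul]
      refine intervalIntegral.integral_congr fun r hr => ?_
      rw [uIcc_of_le t.coe_nonneg] at hr
      simp only [rescale_op_apply, B.map_smul_of_tower, (T.op _).map_smul_of_tower, smul_smul,
        ← Real.exp_add, Real.coe_toNNReal _ (sub_nonneg.2 hr.2), Real.coe_toNNReal _ hr.1]
      congr 2
      ring
  · exact C.smul_mem (Real.exp_pos _).le
      (hWC C hC (fun t x hx => C.smul_mem (Real.exp_pos _).le (hTC t hx)) hBC t hx)

/-- The generator of a semigroup that satisfies the variation of constants formula. -/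
theorem generator_eq_vadd_of_duhamel [IsScalarTower ℝ 𝕜 X] {T U : C0Semigroup 𝕜 X} {B : X →L[𝕜] X}
    (h : ∀ t x, U.op t x = T.op t x + T.duhamel B (fun r => U.op r x) t) :
    U.generator = (B : X →ₗ[𝕜] X) +ᵥ T.generator := by
  have hd : ∀ x y, U.HasRightDerivAtZero x y ↔ T.HasRightDerivAtZero x (y - B x) := by
    intro x y
    have hB := T.hasDerivWithinAt_duhamel B (U.continuous_orbit x)
    rw [op_zero_apply] at hB
    rw [hasRightDerivAtZero_iff_hasDerivWithinAt, hasRightDerivAtZero_iff_hasDerivWithinAt]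
    constructor
    · intro hU
      refine (hU.sub hB).congr (fun r _ => ?_) ?_ <;>
        exact eq_sub_of_add_eq (h _ x).symm
    · intro hT
      have := hT.add hB
      rw [sub_add_cancel] at this
      exact this.congr (fun r _ => h _ x) (h _ x)
  refine LinearPMap.eq_of_eq_graph (Submodule.ext fun p => ?_)
  obtain ⟨x, y⟩ := p
  rw [mem_graph_generator_iff, hd, ← mem_graph_generator_iff, LinearPMap.mem_graph_iff,
    LinearPMap.mem_graph_iff]
  refine exists_congr fun z => and_congr_right fun hz => ?_
  obtain rfl : (z : X) = x := hz
  rw [LinearPMap.vadd_apply, eq_sub_iff_add_eq, add_comm]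
  rfl

end C0Semigroup

/-- The elements `x ∈ D(S)` with `S x ≥ 0` as a cone. -/
def shapePointedCone {𝕜 : Type*} [RCLike 𝕜] {X : Type*} [NormedAddCommGroup X] [NormedSpace 𝕜 X]
    [NormedSpace ℝ X] [IsScalarTower ℝ 𝕜 X]
    {Y : Type*} [NormedAddCommGroup Y] [NormedSpace 𝕜 Y] [PartialOrder Y] [IsOrderedAddMonoid Y]
    (hY_smul : ∀ (r : ℝ) (y : Y), 0 ≤ r → 0 ≤ y → 0 ≤ (r : 𝕜) • y) (S : X →ₗ.[𝕜] Y) :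
    PointedCone ℝ X where
  carrier := {x | ∃ hx : x ∈ S.domain, 0 ≤ S ⟨x, hx⟩}
  zero_mem' := ⟨S.domain.zero_mem, (S.map_zero).ge⟩
  add_mem' := by
    rintro x y ⟨hx, hx0⟩ ⟨hy, hy0⟩
    refine ⟨S.domain.add_mem hx hy, ?_⟩
    have := S.map_add ⟨x, hx⟩ ⟨y, hy⟩
    exact (add_nonneg hx0 hy0).trans_eq this.symm
  smul_mem' := by
    rintro ⟨r, hr⟩ x ⟨hx, hx0⟩
    have e : (⟨r, hr⟩ : {r : ℝ // 0 ≤ r}) • x = (r : 𝕜) • x := (algebraMap_smul 𝕜 r x).symm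
    rw [e]
    refine ⟨S.domain.smul_mem _ hx, ?_⟩
    exact (hY_smul r _ hr hx0).trans_eq (S.map_smul (r : 𝕜) ⟨x, hx⟩).symm

/-- `X` is a Banach space, `Y` an ordered Banach space with closed positive cone (both over
`𝕜 = ℝ` or `ℂ`), `S` a closed linear operator from `X` to `Y`. The operator `B +ᵥ A` is the sum
`A + B` with domain `D(A)`. -/
theorem mainTheorem5 {𝕜 : Type*} [RCLike 𝕜]
    {X : Type*} [NormedAddCommGroup X] [NormedSpace 𝕜 X] [CompleteSpace X]
    {Y : Type*} [NormedAddCommGroup Y] [NormedSpace 𝕜 Y] [CompleteSpace Y]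
    [PartialOrder Y] [IsOrderedAddMonoid Y]
    (hY_smul : ∀ (r : ℝ) (y : Y), 0 ≤ r → 0 ≤ y → 0 ≤ (r : 𝕜) • y)
    (hY_closed : IsClosed {y : Y | 0 ≤ y})
    (S : X →ₗ.[𝕜] Y) (hS : S.IsClosed)
    (A : X →ₗ.[𝕜] X)
    (hA : ∃ T : C0Semigroup 𝕜 X, T.generator = A ∧ T.PreservesShape S)
    (B : X →L[𝕜] X) (hB : MapsTo B (shapeCone S) (shapeCone S)) :
    (∃ U : C0Semigroup 𝕜 X, U.generator = (B : X →ₗ[𝕜] X) +ᵥ A) ∧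
      ∀ U : C0Semigroup 𝕜 X, U.generator = (B : X →ₗ[𝕜] X) +ᵥ A → U.PreservesShape S := by

  -- Integrals and cones need real scalars, also when `𝕜 = ℂ`.
  let _ : NormedSpace ℝ X := NormedSpace.restrictScalars ℝ 𝕜 X
  have _ : IsScalarTower ℝ 𝕜 X := RestrictScalars.isScalarTower ℝ 𝕜 X
  obtain ⟨T, rfl, hTA, hTC⟩ := hA
  obtain ⟨U, hU, hUC⟩ := T.exists_duhamel B
  have hgen := C0Semigroup.generator_eq_vadd_of_duhamel hU
  refine ⟨⟨U, hgen⟩, fun U' hU' => ?_⟩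
  obtain rfl : U' = U := C0Semigroup.eq_of_generator_eq (hU'.trans hgen.symm)
  refine ⟨?_, hUC (shapePointedCone hY_smul S).closure isClosed_closure hTC hB⟩
  -- Adding `B` leaves the domain of the generator unchanged, so `hTA` applies by definitional
  -- unfolding.
  rw [hU']
  exact hTA
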